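/- Let $n\ge 0$. Let $\mathcal M_n$ be the space of all ordered triples $(\ell_1,\ell_2,\ell_3)$ of projective lines in $\mathbb{RP}^n$ such that each line of the triple intersects the two others in single points, and these two points are distinct; lines are identified with $2$-dimensional linear subspaces of $\mathbb R^{n+1}$, and $\mathcal M_n$ has the subspace topology from the product of three copies of the Grassmannian $\mathrm{Gr}(2,\mathbb R^{n+1})$. Let $\mathrm{Flag}(1,2,3;\mathbb R^{n+1})$ be the real partial flag variety of all flags $0\subset V_1\subset V_2\subset V_3\subset\mathbb R^{n+1}$ with $\dim V_i=i$ (signature $(0,1,2,3,n+1)$; for $n=2$ these are the complete flags of $\mathbb R^3$, and for $n\le 1$ both spaces are empty), with the subspace topology from the product of Grassmannians. Then $\mathcal M_n$ and $\mathrm{Flag}(1,2,3;\mathbb R^{n+1})$ are homotopy equivalent. More precisely, the following two maps are well defined and continuous, and are homotopy inverse to each other. The map $f:\mathcal M_n\to \mathrm{Flag}(1,2,3;\mathbb R^{n+1})$ sends $(\ell_1,\ell_2,\ell_3)$ to the flag $\langle e_1\rangle\subset\langle e_1,e_2\rangle\subset\langle e_1,e_2,e_3\rangle$, where $e_i$ is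 any nonzero vector orthogonal to $\ell_i$ in the $3$-dimensional subspace $\ell_1+\ell_2+\ell_3$ of $\mathbb R^{n+1}$. The map $g:\mathrm{Flag}(1,2,3;\mathbb R^{n+1})\to\mathcal M_n$ sends a flag $V_1\subset V_2\subset V_3$ to $(\ell_1,\ell_2,\ell_3)$, where $(e_1,e_2,e_3)$ is any orthonormal triple with $V_1=\langle e_1\rangle$, $V_2=\langle e_1,e_2\rangle$, $V_3=\langle e_1,e_2,e_3\rangle$, and $\ell_i$ is the orthogonal complement of $e_i$ in $V_3$. -/

import Mathlib

open ContinuousMap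
open scoped LinearAlgebra.Projectivization

noncomputable section

/-- Real projective space `ℝPⁿ` is the projectivization of this Euclidean space. -/
abbrev AmbientSpace (n : ℕ) : Type := EuclideanSpace ℝ (Fin (n + 1))

/-- The real Grassmannian of `k`-dimensional linear subspaces of `ℝⁿ⁺¹`. -/
def RealGrassmannian (k n : ℕ) : Type :=
  {W : Submodule ℝ (AmbientSpace n) // Module.finrank ℝ W = k}

namespace RealGrassmannian

variable {k n : ℕ}

/-- The underlying linear subspace. -/
def toSubmodule (W : RealGrassmannian k n) : Submodule ℝ (AmbientSpace n) := W.1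

/-- The usual topology of the Grassmannian: a subspace is identified with the orthogonal
projection onto it, an element of the normed space of operators (so the topology is that of
the gap metric `‖P_V - P_W‖`). It is the same as the quotient topology from orthonormal
`k`-frames, since these form a compact space and the set of projections is Hausdorff. -/
instance : TopologicalSpace (RealGrassmannian k n) :=
  TopologicalSpace.induced
    (fun W => (W.toSubmodule.starProjection : AmbientSpace n →L[ℝ] AmbientSpace n))
    inferInstance

/-- The set of points of `ℝPⁿ` lying on the projective subspace given by `W`. -/
def points (W : RealGrassmannian k n) : Set (ℙ ℝ (AmbientSpace n)) :=
  {P | P.submodule ≤ W.toSubmodule}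

end RealGrassmannian

/-- The space of projective lines in `ℝPⁿ`, that is, of `2`-dimensional subspaces of `ℝⁿ⁺¹`. -/
abbrev ProjLine (n : ℕ) : Type := RealGrassmannian 2 n

/-- `a` intersects `b` and `c` at distinct points of `ℝPⁿ`. -/
def ProjLine.MeetsAtDistinctPoints {n : ℕ} (a b c : ProjLine n) : Prop :=
  ∃ P Q : ℙ ℝ (AmbientSpace n), P ≠ Q ∧
    a.points ∩ b.points = {P} ∧ a.points ∩ c.points = {Q}

/-- The space of (ordered) triples of projective lines in `ℝPⁿ` such that each line of the triple
intersects the two others at distinct points, as a subspace of the triple product. -/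
abbrev LineTriples (n : ℕ) : Type :=
  {ℓ : Fin 3 → ProjLine n //
    (ℓ 0).MeetsAtDistinctPoints (ℓ 1) (ℓ 2) ∧
    (ℓ 1).MeetsAtDistinctPoints (ℓ 0) (ℓ 2) ∧
    (ℓ 2).MeetsAtDistinctPoints (ℓ 0) (ℓ 1)}

/-- The real partial flag variety `Flag(1,2,3; ℝⁿ⁺¹)`: flags `0 < V₁ < V₂ < V₃ ≤ ℝⁿ⁺¹` with
`dim Vᵢ = i`, as a subspace of the product of Grassmannians. -/
abbrev Flag123 (n : ℕ) : Type :=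
  {F : RealGrassmannian 1 n × RealGrassmannian 2 n × RealGrassmannian 3 n //
    F.1.toSubmodule ≤ F.2.1.toSubmodule ∧ F.2.1.toSubmodule ≤ F.2.2.toSubmodule}

namespace Flag123

variable {n : ℕ}

/-- The line `V₁` of the flag. -/
def V₁ (F : Flag123 n) : Submodule ℝ (AmbientSpace n) := F.1.1.toSubmodule

/-- The plane `V₂` of the flag. -/
def V₂ (F : Flag123 n) : Submodule ℝ (AmbientSpace n) := F.1.2.1.toSubmodule

/-- The `3`-space `V₃` of the flag. -/
def V₃ (F : Flag123 n) : Submodule ℝ (AmbientSpace n) := F.1.2.2.toSubmodule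

/-- `F` is the flag spanned successively by the vectors `e 0`, `e 1`, `e 2`. -/
def IsSpannedBy (F : Flag123 n) (e : Fin 3 → AmbientSpace n) : Prop :=
  F.V₁ = Submodule.span ℝ {e 0} ∧
  F.V₂ = Submodule.span ℝ {e 0, e 1} ∧
  F.V₃ = Submodule.span ℝ {e 0, e 1, e 2}

end Flag123

namespace LineTriples

variable {n : ℕ}

/-- The linear subspace of `ℝⁿ⁺¹` of the `i`-th line of the triple. -/
def line (p : LineTriples n) (i : Fin 3) : Submodule ℝ (AmbientSpace n) :=
  (p.1 i).toSubmodule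

/-- The linear subspace of `ℝⁿ⁺¹` spanned by the three lines (it is of dimension `3`). -/
def commonSpace (p : LineTriples n) : Submodule ℝ (AmbientSpace n) := ⨆ i, p.line i

/-- `e i` is a nonzero normal vector to the `i`-th line inside the common `3`-space. -/
def IsNormalFrame (p : LineTriples n) (e : Fin 3 → AmbientSpace n) : Prop :=
  ∀ i, e i ≠ 0 ∧ e i ∈ p.commonSpace ∧ e i ∈ (p.line i)ᗮ

end LineTriples

end

/-!
Inside the common `3`-space, taking orthogonal complements exchanges the sides of a triangle of
lines with three independent points, and this polar duality is a homeomorphism. It remains to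
compare independent triples of points with flags. The orthogonal frame of a flag spans the flag.
Conversely, the orthogonal frame of the flag spanned by three points is the result of the
Gram-Schmidt process, which can be performed linearly in time: at time `t` one subtracts from each
point `t` times its projection to the span of the previous ones. This never changes the spans of the
initial subfamilies, so the points stay independent throughout the deformation.

All continuity statements reduce to one: the projection onto a line depends continuously on the line
when the latter is the range of a continuously varying operator.
-/

open Module Finset

section PartialSups

variable {α ι : Type*} [SemilatticeSup α] [OrderBot α] [PartialOrder ι] [LocallyFiniteOrderBot ι]

theorem sup_Iio_sup (f : ι → α) (i : ι) : (Iio i).sup f ⊔ f i = (Iic i).sup f := by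
  classical rw [← Iio_insert, sup_insert, sup_comm]

theorem sup_sup_Iic (f : ι → α) {s : Finset ι} (hs : IsLowerSet (s : Set ι)) :
    (s.sup fun i => (Iic i).sup f) = s.sup f :=
  le_antisymm (Finset.sup_le fun _ hi => sup_mono fun _ hj => hs (mem_Iic.1 hj) hi)
    (sup_mono_fun fun _ _ => le_sup (mem_Iic.2 le_rfl))

end PartialSups

section LinearAlgebra

variable {K V ι : Type*} [DivisionRing K] [AddCommGroup V] [Module K V]

theorem inf_ne_inf_iff_of_finrank_eq_one {A B C : Submodule K V}
    (hAB : finrank K (A ⊓ B : Submodule K V) = 1) (hAC : finrank K (A ⊓ C : Submodule K V) = 1) :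
    A ⊓ B ≠ A ⊓ C ↔ A ⊓ B ⊓ C = ⊥ := by
  have atomAB := Submodule.isAtom_iff_finrank_eq_one.2 hAB
  have atomAC := Submodule.isAtom_iff_finrank_eq_one.2 hAC
  rw [inf_assoc, inf_inf_distrib_left, ← disjoint_iff]
  exact ⟨atomAB.disjoint_of_ne atomAC, fun h => h.ne atomAB.1⟩

theorem le_sup_of_finrank_le_add_finrank_inf [FiniteDimensional K V] {A B C : Submodule K V}
    (hinf : A ⊓ B ⊓ C = ⊥)
    (h : finrank K C ≤
      finrank K (A ⊓ C : Submodule K V) + finrank K (B ⊓ C : Submodule K V)) :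
    C ≤ A ⊔ B := by
  have hdim := Submodule.finrank_sup_add_finrank_inf_eq (A ⊓ C) (B ⊓ C)
  rw [← inf_inf_distrib_right, hinf, finrank_bot, add_zero] at hdim
  have hC : A ⊓ C ⊔ B ⊓ C = C :=
    Submodule.eq_of_le_of_finrank_le (sup_le inf_le_right inf_le_right) (hdim ▸ h)
  exact hC ▸ sup_le_sup inf_le_left inf_le_left

theorem eq_span_singleton_of_finrank_eq_one {L : Submodule K V} (hL : finrank K L = 1) {v : V}
    (hv : v ∈ L) (hv₀ : v ≠ 0) : L = K ∙ v :=
  have : FiniteDimensional K L := FiniteDimensional.of_finrank_pos (hL ▸ one_pos)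
  (Submodule.eq_of_le_of_finrank_eq ((Submodule.span_singleton_le_iff_mem v L).2 hv)
    ((finrank_span_singleton hv₀).trans hL.symm)).symm

theorem iSupIndep_iff_finrank_iSup_eq_card [Fintype ι] {L : ι → Submodule K V}
    (hL : ∀ i, finrank K (L i) = 1) :
    iSupIndep L ↔ finrank K (⨆ i, L i : Submodule K V) = Fintype.card ι := by
  have hgen : ∀ i, ∃ v ∈ L i, v ≠ 0 := fun i =>
    (L i).ne_bot_iff.1 (Submodule.isAtom_iff_finrank_eq_one.2 (hL i)).1
  choose v hv hv₀ using hgen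
  obtain rfl : L = fun i => K ∙ v i :=
    funext fun i => eq_span_singleton_of_finrank_eq_one (hL i) (hv i) (hv₀ i)
  rw [iSupIndep_iff_linearIndependent_of_ne_zero hv₀, linearIndependent_iff_card_eq_finrank_span,
    Set.finrank, Submodule.span_range_eq_iSup, eq_comm]

theorem finrank_finsetSup_eq_card {L : ι → Submodule K V} (hL : ∀ i, finrank K (L i) = 1)
    (hind : iSupIndep L) (s : Finset ι) : finrank K (s.sup L : Submodule K V) = #s := by
  rw [s.sup_eq_iSup, iSup_subtype', ← Fintype.card_coe]
  exact (iSupIndep_iff_finrank_iSup_eq_card fun i : s => hL i).1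
    (hind.comp Subtype.val_injective)

end LinearAlgebra

section OrthogonalComplement

variable {𝕜 E ι : Type*} [RCLike 𝕜] [NormedAddCommGroup E] [InnerProductSpace 𝕜 E]

theorem sup_inf_orthogonal {U V : Submodule 𝕜 E} [U.HasOrthogonalProjection] (h : U ≤ V) :
    U ⊔ V ⊓ Uᗮ = V := by
  rw [inf_comm, Submodule.sup_orthogonal_inf_of_hasOrthogonalProjection h]

theorem inf_orthogonal_inf_orthogonal {U V : Submodule 𝕜 E} [U.HasOrthogonalProjection]
    (h : U ≤ V) : V ⊓ (V ⊓ Uᗮ)ᗮ = U := by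
  have hU : U ≤ (V ⊓ Uᗮ)ᗮ := U.le_orthogonal_orthogonal.trans (Submodule.orthogonal_le inf_le_right)
  calc V ⊓ (V ⊓ Uᗮ)ᗮ = (U ⊔ V ⊓ Uᗮ) ⊓ (V ⊓ Uᗮ)ᗮ := by rw [sup_inf_orthogonal h]
    _ = U ⊔ (V ⊓ Uᗮ) ⊓ (V ⊓ Uᗮ)ᗮ := sup_inf_assoc_of_le _ hU
    _ = U := by rw [Submodule.inf_orthogonal_eq_bot, sup_bot_eq]

theorem finrank_inf_orthogonal_add_finrank {U V : Submodule 𝕜 E} [FiniteDimensional 𝕜 V]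
    (h : U ≤ V) : finrank 𝕜 (V ⊓ Uᗮ : Submodule 𝕜 E) + finrank 𝕜 U = finrank 𝕜 V := by
  rw [inf_comm, add_comm, Submodule.finrank_add_inf_finrank_orthogonal h]

theorem starProjection_inf_orthogonal {U V : Submodule 𝕜 E} [U.HasOrthogonalProjection]
    [V.HasOrthogonalProjection] [(V ⊓ Uᗮ).HasOrthogonalProjection] (h : U ≤ V) :
    (V ⊓ Uᗮ).starProjection = V.starProjection - U.starProjection := by
  ext x
  change (V ⊓ Uᗮ).starProjection x = V.starProjection x - U.starProjection x
  refine Submodule.eq_starProjection_of_mem_orthogonal (Submodule.mem_inf.2 ⟨?_, ?_⟩) ?_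
  · exact V.sub_mem (V.starProjection_apply_mem x) (h (U.starProjection_apply_mem x))
  · have hU : V.starProjection x - U.starProjection x =
        V.starProjection x - U.starProjection (V.starProjection x) := by
      rw [← ContinuousLinearMap.comp_apply, Submodule.starProjection_comp_starProjection_of_le h]
    exact hU ▸ U.sub_starProjection_mem_orthogonal (V.starProjection x)
  · have hV := Submodule.orthogonal_le (inf_le_left : V ⊓ Uᗮ ≤ V)
      (V.sub_starProjection_mem_orthogonal x)
    have hU := Submodule.orthogonal_le (inf_le_right : V ⊓ Uᗮ ≤ Uᗮ)
      (U.le_orthogonal_orthogonal (U.starProjection_apply_mem x))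
    simpa only [sub_add] using add_mem hV hU

/-- The family dual to `L` inside its span: the `i`-th member is the orthogonal complement of
`L i` in `⨆ j, L j`. On triples, it exchanges the sides of a triangle of projective lines and the
vertices of the polar triangle. -/
def dualFamily (L : ι → Submodule 𝕜 E) (i : ι) : Submodule 𝕜 E := (⨆ j, L j) ⊓ (L i)ᗮ

theorem iSup_dualFamily [FiniteDimensional 𝕜 E] {L : ι → Submodule 𝕜 E} (h : ⨅ i, L i = ⊥) :
    ⨆ i, dualFamily L i = ⨆ i, L i := by
  have hle : ⨆ i, dualFamily L i ≤ ⨆ i, L i := iSup_le fun i => inf_le_left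
  have hcompl : (⨆ i, L i) ⊓ (⨆ i, dualFamily L i)ᗮ = ⊥ :=
    le_bot_iff.1 <| h ▸ le_iInf fun i =>
      (inf_le_inf_left _ (Submodule.orthogonal_le (le_iSup (dualFamily L) i))).trans
        (inf_orthogonal_inf_orthogonal (le_iSup L i)).le
  simpa only [hcompl, sup_bot_eq] using sup_inf_orthogonal hle

theorem dualFamily_dualFamily [FiniteDimensional 𝕜 E] {L : ι → Submodule 𝕜 E}
    (h : ⨅ i, L i = ⊥) : dualFamily (dualFamily L) = L := by
  funext i
  rw [dualFamily, iSup_dualFamily h]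
  exact inf_orthogonal_inf_orthogonal (le_iSup L i)

theorem iInf_dualFamily [Nonempty ι] (L : ι → Submodule 𝕜 E) : ⨅ i, dualFamily L i = ⊥ := by
  simp only [dualFamily, ← inf_iInf, Submodule.iInf_orthogonal, Submodule.inf_orthogonal_eq_bot]

theorem finrank_dualFamily_add_finrank [FiniteDimensional 𝕜 E] (L : ι → Submodule 𝕜 E) (i : ι) :
    finrank 𝕜 (dualFamily L i) + finrank 𝕜 (L i) = finrank 𝕜 (⨆ j, L j : Submodule 𝕜 E) :=
  finrank_inf_orthogonal_add_finrank (le_iSup L i)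

theorem finrank_dualFamily_inf_add_finrank_sup [FiniteDimensional 𝕜 E] (L : ι → Submodule 𝕜 E)
    (i j : ι) : finrank 𝕜 (dualFamily L i ⊓ dualFamily L j : Submodule 𝕜 E) +
      finrank 𝕜 (L i ⊔ L j : Submodule 𝕜 E) = finrank 𝕜 (⨆ k, L k : Submodule 𝕜 E) := by
  rw [dualFamily, dualFamily, ← inf_inf_distrib_left, Submodule.inf_orthogonal]
  exact finrank_inf_orthogonal_add_finrank (sup_le (le_iSup L i) (le_iSup L j))

end OrthogonalComplement

section Tilt

variable {𝕜 E : Type*} [RCLike 𝕜] [NormedAddCommGroup E] [InnerProductSpace 𝕜 E]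

/-- The subspace `W` pushed off `U`: its image under `x ↦ x - t • P x`, where `P` is the orthogonal
projection onto `U`. It moves from `W` at `t = 0` to the projection of `W` to `Uᗮ` at `t = 1`. -/
noncomputable def tilt (t : 𝕜) (U W : Submodule 𝕜 E) [U.HasOrthogonalProjection] :
    Submodule 𝕜 E :=
  W.map (ContinuousLinearMap.id 𝕜 E - t • U.starProjection).toLinearMap

variable (t : 𝕜) (U W : Submodule 𝕜 E) [U.HasOrthogonalProjection]

theorem mem_tilt {x : E} : x ∈ tilt t U W ↔ ∃ w ∈ W, w - t • U.starProjection w = x := Iff.rfl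

@[simp]
theorem tilt_zero : tilt 0 U W = W := by
  ext x
  simp [mem_tilt]

variable {U W} in
theorem tilt_of_isOrtho (h : W ⟂ U) : tilt t U W = W := by
  ext x
  rw [mem_tilt]
  refine ⟨?_, fun hx => ⟨x, hx, ?_⟩⟩
  · rintro ⟨w, hw, rfl⟩
    simpa [U.starProjection_apply_eq_zero_iff.2 (h hw)]
  · simp [U.starProjection_apply_eq_zero_iff.2 (h hx)]

theorem sup_tilt : U ⊔ tilt t U W = U ⊔ W := by
  have hU (w : E) : t • U.starProjection w ∈ U := U.smul_mem t (U.starProjection_apply_mem w)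
  refine le_antisymm (sup_le le_sup_left ?_) (sup_le le_sup_left fun w hw => ?_)
  · rintro _ ⟨w, hw, rfl⟩
    exact sub_mem (Submodule.mem_sup_right hw) (Submodule.mem_sup_left (hU w))
  · rw [← sub_add_cancel w (t • U.starProjection w)]
    exact add_mem (Submodule.mem_sup_right ⟨w, hw, rfl⟩) (Submodule.mem_sup_left (hU w))

theorem tilt_one : tilt 1 U W = (U ⊔ W) ⊓ Uᗮ := by
  have hle : tilt 1 U W ≤ Uᗮ := by
    rintro _ ⟨w, -, rfl⟩
    simp
  calc tilt 1 U W = tilt 1 U W ⊔ U ⊓ Uᗮ := by rw [Submodule.inf_orthogonal_eq_bot, sup_bot_eq]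
    _ = (tilt 1 U W ⊔ U) ⊓ Uᗮ := (sup_inf_assoc_of_le U hle).symm
    _ = (U ⊔ W) ⊓ Uᗮ := by rw [sup_comm, sup_tilt]

variable {U W} in
theorem finrank_tilt (h : Disjoint W U) : finrank 𝕜 (tilt t U W) = finrank 𝕜 W := by
  have hinj : Function.Injective ((ContinuousLinearMap.id 𝕜 E -
      t • U.starProjection).toLinearMap.domRestrict W) := by
    refine LinearMap.injective_domRestrict_iff.2 (h.mono_right fun x hx => ?_)
    replace hx : x - t • U.starProjection x = 0 := hx
    exact sub_eq_zero.1 hx ▸ U.smul_mem t (U.starProjection_apply_mem x)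
  rw [tilt, ← LinearMap.range_domRestrict, LinearMap.finrank_range_of_inj hinj]

end Tilt

section GramSchmidt

variable {𝕜 E ι : Type*} [RCLike 𝕜] [NormedAddCommGroup E] [InnerProductSpace 𝕜 E]
  [FiniteDimensional 𝕜 E] [LinearOrder ι] [LocallyFiniteOrderBot ι]

/-- The Gram-Schmidt process for a family of subspaces, stopped at time `t`: at `t = 0` the family
is unchanged, at `t = 1` each member is projected to the complement of the previous ones. -/
noncomputable def gramSchmidtFamily (t : 𝕜) (L : ι → Submodule 𝕜 E) (i : ι) : Submodule 𝕜 E :=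
  tilt t ((Iio i).sup L) (L i)

@[simp]
theorem gramSchmidtFamily_zero (L : ι → Submodule 𝕜 E) : gramSchmidtFamily (0 : 𝕜) L = L :=
  funext fun i => tilt_zero _ (L i)

theorem gramSchmidtFamily_one (L : ι → Submodule 𝕜 E) (i : ι) :
    gramSchmidtFamily (1 : 𝕜) L i = (Iic i).sup L ⊓ ((Iio i).sup L)ᗮ := by
  rw [gramSchmidtFamily, tilt_one, sup_Iio_sup]

theorem finrank_gramSchmidtFamily_one_add_finrank (L : ι → Submodule 𝕜 E) (i : ι) :
    finrank 𝕜 (gramSchmidtFamily (1 : 𝕜) L i) + finrank 𝕜 ((Iio i).sup L : Submodule 𝕜 E) =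
      finrank 𝕜 ((Iic i).sup L : Submodule 𝕜 E) := by
  rw [gramSchmidtFamily_one,
    finrank_inf_orthogonal_add_finrank (sup_Iio_sup L i ▸ le_sup_left)]

theorem gramSchmidtFamily_of_pairwise_isOrtho (t : 𝕜) {L : ι → Submodule 𝕜 E}
    (hL : Pairwise fun i j => L i ⟂ L j) : gramSchmidtFamily t L = L := by
  funext i
  refine tilt_of_isOrtho t ?_
  simp only [Finset.sup_eq_iSup, Submodule.isOrtho_iSup_right, mem_Iio]
  exact fun j hj => hL hj.ne'

theorem gramSchmidtFamily_one_sup_Iic (L : ι → Submodule 𝕜 E) :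
    gramSchmidtFamily (1 : 𝕜) (fun i => (Iic i).sup L) = gramSchmidtFamily 1 L := by
  funext i
  have hIic := sup_sup_Iic L (coe_Iic i ▸ isLowerSet_Iic i)
  have hIio := sup_sup_Iic L (coe_Iio i ▸ isLowerSet_Iio i)
  rw [gramSchmidtFamily_one, gramSchmidtFamily_one, hIic, hIio]

theorem pairwise_isOrtho_gramSchmidtFamily_one (L : ι → Submodule 𝕜 E) :
    Pairwise fun i j => gramSchmidtFamily (1 : 𝕜) L i ⟂ gramSchmidtFamily (1 : 𝕜) L j := by
  have hlt {i j : ι} (hij : i < j) :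
      gramSchmidtFamily (1 : 𝕜) L i ⟂ gramSchmidtFamily (1 : 𝕜) L j := by
    rw [gramSchmidtFamily_one, gramSchmidtFamily_one]
    exact ((Iio j).sup L).isOrtho_orthogonal_right.mono
      (inf_le_left.trans (sup_mono fun k hk => mem_Iio.2 ((mem_Iic.1 hk).trans_lt hij)))
      inf_le_right
  exact fun i j hij => hij.lt_or_gt.elim hlt fun hji => (hlt hji).symm

theorem sup_gramSchmidtFamily [WellFoundedLT ι] (t : 𝕜) (L : ι → Submodule 𝕜 E) {s : Finset ι}
    (hs : IsLowerSet (s : Set ι)) : s.sup (gramSchmidtFamily t L) = s.sup L := by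
  have hIic (i : ι) : (Iic i).sup (gramSchmidtFamily t L) = (Iic i).sup L := by
    induction i using WellFoundedLT.induction with
    | ind i ih =>
      have hIio : (Iio i).sup (gramSchmidtFamily t L) = (Iio i).sup L := by
        have hlower := coe_Iio i ▸ isLowerSet_Iio i
        rw [← sup_sup_Iic _ hlower, ← sup_sup_Iic L hlower]
        exact sup_congr rfl fun j hj => ih j (mem_Iio.1 hj)
      rw [← sup_Iio_sup, ← sup_Iio_sup, hIio, gramSchmidtFamily, sup_tilt]
  rw [← sup_sup_Iic _ hs, ← sup_sup_Iic L hs]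
  exact sup_congr rfl fun i _ => hIic i

theorem finrank_gramSchmidtFamily (t : 𝕜) {L : ι → Submodule 𝕜 E} (h : iSupIndep L) (i : ι) :
    finrank 𝕜 (gramSchmidtFamily t L i) = finrank 𝕜 (L i) := by
  refine finrank_tilt t ?_
  rw [Finset.sup_eq_iSup]
  exact h.disjoint_biSup (by simp)

theorem iSupIndep_gramSchmidtFamily [Finite ι] (t : 𝕜) {L : ι → Submodule 𝕜 E}
    (hL : ∀ i, finrank 𝕜 (L i) = 1) (h : iSupIndep L) : iSupIndep (gramSchmidtFamily t L) := by
  have := Fintype.ofFinite ι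
  refine (iSupIndep_iff_finrank_iSup_eq_card fun i =>
    (finrank_gramSchmidtFamily t h i).trans (hL i)).2 ?_
  rw [← sup_univ_eq_iSup, sup_gramSchmidtFamily t L (coe_univ (α := ι) ▸ isLowerSet_univ),
    sup_univ_eq_iSup]
  exact (iSupIndep_iff_finrank_iSup_eq_card hL).1 h

theorem iSupIndep_gramSchmidtFamily_one (L : ι → Submodule 𝕜 E) :
    iSupIndep (gramSchmidtFamily (1 : 𝕜) L) :=
  (OrthogonalFamily.of_pairwise (pairwise_isOrtho_gramSchmidtFamily_one L)).independent

end GramSchmidt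

section Continuity

variable {𝕜 E F X ι : Type*} [RCLike 𝕜] [NormedAddCommGroup E] [InnerProductSpace 𝕜 E]
  [FiniteDimensional 𝕜 E] [NormedAddCommGroup F] [NormedSpace 𝕜 F] [TopologicalSpace X]

theorem continuous_starProjection_range {A : X → F →L[𝕜] E} (hA : Continuous A)
    (h : ∀ x, finrank 𝕜 (A x).range = 1) : Continuous fun x => (A x).range.starProjection := by
  -- A single vector `w` with `A x w ≠ 0` still yields a generator `A y w` of the range for `y` near
  -- `x`, and the projection onto a line is given by a formula in its generator.
  refine continuous_iff_continuousAt.2 fun x => ?_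
  obtain ⟨w, hw⟩ : ∃ w, A x w ≠ 0 := by
    by_contra! hA₀
    have hrange : (A x).range = ⊥ := LinearMap.range_eq_bot.2 (LinearMap.ext hA₀)
    exact one_ne_zero ((h x).symm.trans (hrange ▸ finrank_bot 𝕜 E))
  have hAw : Continuous fun y => A y w := hA.clm_apply continuous_const
  have hformula : ∀ᶠ y in nhds x, (A y).range.starProjection =
      ((‖A y w‖ ^ 2 : ℝ) : 𝕜)⁻¹ • InnerProductSpace.rankOne 𝕜 (A y w) (A y w) := by
    filter_upwards [hAw.continuousAt.eventually_ne hw] with y hy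
    ext v
    simp [eq_span_singleton_of_finrank_eq_one (h y) ⟨w, rfl⟩ hy, Submodule.starProjection_singleton,
      div_eq_inv_mul, mul_smul]
  have hscalar : ContinuousAt (fun y => ((‖A y w‖ ^ 2 : ℝ) : 𝕜)⁻¹) x :=
    ContinuousAt.inv₀ (by fun_prop) (by simpa using hw)
  have hrankOne : Continuous fun y => InnerProductSpace.rankOne 𝕜 (A y w) (A y w) :=
    (ContinuousLinearMap.smulRightL 𝕜 E E).continuous₂.comp
      (((innerSL 𝕜).continuous.comp hAw).prodMk hAw)
  exact (hscalar.smul hrankOne.continuousAt).congr (hformula.mono fun y hy => hy.symm)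

theorem continuous_starProjection_inf_orthogonal {U V : X → Submodule 𝕜 E}
    (hU : Continuous fun x => (U x).starProjection) (hV : Continuous fun x => (V x).starProjection)
    (h : ∀ x, U x ≤ V x) : Continuous fun x => (V x ⊓ (U x)ᗮ).starProjection := by
  simp only [starProjection_inf_orthogonal (h _)]
  exact hV.sub hU

theorem continuous_starProjection_tilt {t : X → 𝕜} {U W : X → Submodule 𝕜 E} (ht : Continuous t)
    (hU : Continuous fun x => (U x).starProjection) (hW : Continuous fun x => (W x).starProjection)
    (h : ∀ x, finrank 𝕜 (tilt (t x) (U x) (W x)) = 1) :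
    Continuous fun x => (tilt (t x) (U x) (W x)).starProjection := by
  have hrange (x : X) : tilt (t x) (U x) (W x) =
      ((ContinuousLinearMap.id 𝕜 E - t x • (U x).starProjection) ∘L
        (W x).starProjection).range := by
    rw [tilt, ContinuousLinearMap.toLinearMap_comp, LinearMap.range_comp]
    congr 1
    exact (W x).range_starProjection.symm
  simp only [hrange]
  exact continuous_starProjection_range ((continuous_const.sub (ht.smul hU)).clm_comp hW)
    fun x => hrange x ▸ h x

theorem continuous_starProjection_sup {U W : X → Submodule 𝕜 E}
    (hU : Continuous fun x => (U x).starProjection) (hW : Continuous fun x => (W x).starProjection)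
    (h : ∀ x, finrank 𝕜 (U x ⊔ W x : Submodule 𝕜 E) = finrank 𝕜 (U x) + 1) :
    Continuous fun x => (U x ⊔ W x).starProjection := by
  have htilt (x : X) : finrank 𝕜 (tilt 1 (U x) (W x)) = 1 := by
    have := finrank_inf_orthogonal_add_finrank (le_sup_left : U x ≤ U x ⊔ W x)
    rw [tilt_one]
    linarith [h x]
  have hsum (x : X) : (U x ⊔ W x).starProjection =
      (U x).starProjection + (tilt 1 (U x) (W x)).starProjection := by
    rw [← sub_eq_iff_eq_add', ← starProjection_inf_orthogonal le_sup_left]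
    simp only [tilt_one]
  simp only [hsum]
  exact hU.add (continuous_starProjection_tilt continuous_const hU hW htilt)

theorem continuous_starProjection_finsetSup {L : X → ι → Submodule 𝕜 E}
    (hL : ∀ i, Continuous fun x => (L x i).starProjection)
    (hrank : ∀ x i, finrank 𝕜 (L x i) = 1) (hind : ∀ x, iSupIndep (L x)) (s : Finset ι) :
    Continuous fun x => (s.sup (L x)).starProjection := by
  classical
  induction s using Finset.induction_on with
  | empty =>
    simp only [sup_empty]
    exact continuous_of_const fun _ _ => rfl
  | insert i s hi ih =>
    simp only [sup_insert, sup_comm (L _ i)]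
    refine continuous_starProjection_sup ih (hL i) fun x => ?_
    rw [finrank_finsetSup_eq_card (hrank x) (hind x), sup_comm, ← sup_insert,
      finrank_finsetSup_eq_card (hrank x) (hind x), card_insert_of_notMem hi]

end Continuity

noncomputable section

namespace RealGrassmannian

variable {k l n : ℕ}

theorem continuous_iff {X : Type*} [TopologicalSpace X] {W : X → RealGrassmannian k n} :
    Continuous W ↔ Continuous fun x => (W x).toSubmodule.starProjection :=
  continuous_induced_rng

theorem finrank_toSubmodule (W : RealGrassmannian k n) : finrank ℝ W.toSubmodule = k :=
  W.2

theorem points_inter_points_eq_singleton_iff (a : RealGrassmannian k n)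
    (b : RealGrassmannian l n) (P : ℙ ℝ (AmbientSpace n)) :
    a.points ∩ b.points = {P} ↔ a.toSubmodule ⊓ b.toSubmodule = P.submodule := by
  have mem_inter_iff (Q : ℙ ℝ (AmbientSpace n)) :
      Q ∈ a.points ∩ b.points ↔ Q.submodule ≤ a.toSubmodule ⊓ b.toSubmodule := by
    rw [le_inf_iff]
    rfl
  refine ⟨fun h => le_antisymm (fun v hv => ?_) ((mem_inter_iff P).1 (h ▸ rfl)), fun h => ?_⟩
  · rcases eq_or_ne v 0 with rfl | hv₀
    · exact zero_mem _
    · have hmem : Projectivization.mk ℝ v hv₀ ∈ a.points ∩ b.points := by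
        rwa [mem_inter_iff, Projectivization.submodule_mk, Submodule.span_singleton_le_iff_mem]
      rw [h, Set.mem_singleton_iff] at hmem
      rw [← hmem, Projectivization.submodule_mk]
      exact Submodule.mem_span_singleton_self v
  · ext Q
    rw [mem_inter_iff, h, Set.mem_singleton_iff]
    refine ⟨fun hQ => Projectivization.submodule_injective ?_, fun hQ => hQ ▸ le_rfl⟩
    exact Submodule.eq_of_le_of_finrank_eq hQ
      (Q.finrank_submodule.trans P.finrank_submodule.symm)

end RealGrassmannian

namespace ProjLine

variable {n : ℕ}

theorem meetsAtDistinctPoints_iff (a b c : ProjLine n) :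
    a.MeetsAtDistinctPoints b c ↔
      finrank ℝ (a.toSubmodule ⊓ b.toSubmodule : Submodule ℝ (AmbientSpace n)) = 1 ∧
      finrank ℝ (a.toSubmodule ⊓ c.toSubmodule : Submodule ℝ (AmbientSpace n)) = 1 ∧
      a.toSubmodule ⊓ b.toSubmodule ⊓ c.toSubmodule = ⊥ := by
  simp only [MeetsAtDistinctPoints, RealGrassmannian.points_inter_points_eq_singleton_iff]
  constructor
  · rintro ⟨P, Q, hPQ, hP, hQ⟩
    have hab := hP ▸ P.finrank_submodule
    have hac := hQ ▸ Q.finrank_submodule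
    refine ⟨hab, hac, (inf_ne_inf_iff_of_finrank_eq_one hab hac).1 ?_⟩
    rw [hP, hQ]
    exact Projectivization.submodule_injective.ne hPQ
  · rintro ⟨hab, hac, h⟩
    refine ⟨.mk'' _ hab, .mk'' _ hac, fun heq => ?_, by simp, by simp⟩
    exact (inf_ne_inf_iff_of_finrank_eq_one hab hac).2 h
      (by simpa using congrArg Projectivization.submodule heq)

theorem meetsAtDistinctPoints_triple_iff (ℓ : Fin 3 → ProjLine n) :
    ((ℓ 0).MeetsAtDistinctPoints (ℓ 1) (ℓ 2) ∧ (ℓ 1).MeetsAtDistinctPoints (ℓ 0) (ℓ 2) ∧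
      (ℓ 2).MeetsAtDistinctPoints (ℓ 0) (ℓ 1)) ↔
    (Pairwise fun i j =>
      finrank ℝ ((ℓ i).toSubmodule ⊓ (ℓ j).toSubmodule : Submodule ℝ (AmbientSpace n)) = 1) ∧
    ⨅ i, (ℓ i).toSubmodule = ⊥ := by
  have hiInf : ⨅ i, (ℓ i).toSubmodule = (ℓ 0).toSubmodule ⊓ (ℓ 1).toSubmodule ⊓ (ℓ 2).toSubmodule :=
    iSup_fin_three (α := (Submodule ℝ (AmbientSpace n))ᵒᵈ)
  simp only [meetsAtDistinctPoints_iff, hiInf]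
  constructor
  · rintro ⟨⟨h₀₁, h₀₂, h⟩, ⟨h₁₀, h₁₂, -⟩, h₂₀, h₂₁, -⟩
    refine ⟨fun i j hij => ?_, h⟩
    fin_cases i <;> fin_cases j <;> first | assumption | exact absurd rfl hij
  · rintro ⟨hpair, h⟩
    exact ⟨⟨hpair (by decide), hpair (by decide), h⟩,
      ⟨hpair (by decide), hpair (by decide), by rwa [inf_comm (ℓ 1).toSubmodule]⟩,
      hpair (by decide), hpair (by decide), by rwa [inf_assoc, inf_comm]⟩

end ProjLine

/-- The space of families of linearly independent points of `ℝPⁿ`, a point being regarded as a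
one-dimensional subspace. -/
abbrev IndependentPoints (ι : Type*) (n : ℕ) : Type _ :=
  {K : ι → RealGrassmannian 1 n // iSupIndep fun i => (K i).toSubmodule}

namespace IndependentPoints

variable {ι : Type*} {n : ℕ}

/-- The one-dimensional subspace of `ℝⁿ⁺¹` given by the `i`-th point. -/
def point (K : IndependentPoints ι n) (i : ι) : Submodule ℝ (AmbientSpace n) :=
  (K.1 i).toSubmodule

theorem iSupIndep_point (K : IndependentPoints ι n) : iSupIndep K.point := K.2

theorem finrank_point (K : IndependentPoints ι n) (i : ι) : finrank ℝ (K.point i) = 1 :=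
  (K.1 i).finrank_toSubmodule

theorem point_injective : Function.Injective (point : IndependentPoints ι n → _) :=
  fun _ _ h => Subtype.ext (funext fun i => Subtype.ext (congrFun h i))

theorem continuous_iff {X : Type*} [TopologicalSpace X] {K : X → IndependentPoints ι n} :
    Continuous K ↔ ∀ i, Continuous fun x => ((K x).point i).starProjection :=
  continuous_induced_rng.trans <|
    continuous_pi_iff.trans <| forall_congr' fun _ => RealGrassmannian.continuous_iff

theorem continuous_starProjection_point (i : ι) :
    Continuous fun K : IndependentPoints ι n => (K.point i).starProjection :=
  continuous_iff.1 continuous_id i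

theorem finrank_sup_point (K : IndependentPoints ι n) (s : Finset ι) :
    finrank ℝ (s.sup K.point : Submodule ℝ (AmbientSpace n)) = #s :=
  finrank_finsetSup_eq_card K.finrank_point K.iSupIndep_point s

theorem continuous_starProjection_sup_point (s : Finset ι) :
    Continuous fun K : IndependentPoints ι n => (s.sup K.point).starProjection :=
  continuous_starProjection_finsetSup continuous_starProjection_point finrank_point
    iSupIndep_point s

section GramSchmidt

variable [LinearOrder ι] [LocallyFiniteOrderBot ι] [Finite ι]

/-- The Gram-Schmidt process applied to independent points and stopped at time `t`. -/
def gramSchmidt (t : ℝ) (K : IndependentPoints ι n) : IndependentPoints ι n :=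
  ⟨fun i => ⟨gramSchmidtFamily t K.point i,
    (finrank_gramSchmidtFamily t K.iSupIndep_point i).trans (K.finrank_point i)⟩,
    iSupIndep_gramSchmidtFamily t K.finrank_point K.iSupIndep_point⟩

theorem point_gramSchmidt (t : ℝ) (K : IndependentPoints ι n) :
    (K.gramSchmidt t).point = gramSchmidtFamily t K.point := rfl

theorem gramSchmidt_zero (K : IndependentPoints ι n) : K.gramSchmidt 0 = K :=
  point_injective (gramSchmidtFamily_zero K.point)

theorem continuous_gramSchmidt :
    Continuous fun x : ℝ × IndependentPoints ι n => x.2.gramSchmidt x.1 :=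
  continuous_iff.2 fun i => continuous_starProjection_tilt continuous_fst
    ((continuous_starProjection_sup_point (Iio i)).comp continuous_snd)
    ((continuous_starProjection_point i).comp continuous_snd)
    fun x => (x.2.gramSchmidt x.1).finrank_point i

end GramSchmidt

end IndependentPoints

namespace Flag123

variable {n : ℕ}

/-- The subspaces `V₁`, `V₂`, `V₃` of the flag as a family; as the indices start at `0`,
`F.subspace i` is of dimension `i + 1`. -/
def subspace (F : Flag123 n) : Fin 3 → Submodule ℝ (AmbientSpace n) := ![F.V₁, F.V₂, F.V₃]

theorem finrank_subspace (F : Flag123 n) : ∀ i, finrank ℝ (F.subspace i) = i + 1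
  | 0 => F.1.1.finrank_toSubmodule
  | 1 => F.1.2.1.finrank_toSubmodule
  | 2 => F.1.2.2.finrank_toSubmodule

theorem monotone_subspace (F : Flag123 n) : Monotone F.subspace :=
  Fin.monotone_iff_le_succ.2 (Fin.forall_fin_two.2 F.2)

theorem subspace_injective : Function.Injective (subspace (n := n)) := fun _ _ h =>
  Subtype.ext (Prod.ext (Subtype.ext (congrFun h 0))
    (Prod.ext (Subtype.ext (congrFun h 1)) (Subtype.ext (congrFun h 2))))

theorem continuous_iff {X : Type*} [TopologicalSpace X] {F : X → Flag123 n} :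
    Continuous F ↔ ∀ i, Continuous fun x => ((F x).subspace i).starProjection := by
  rw [continuous_induced_rng, Fin.forall_fin_succ, Fin.forall_fin_two]
  exact continuous_prodMk.trans <| and_congr RealGrassmannian.continuous_iff <|
    continuous_prodMk.trans <|
      and_congr RealGrassmannian.continuous_iff RealGrassmannian.continuous_iff

theorem sup_Iic_subspace (F : Flag123 n) (i : Fin 3) :
    (Iic i).sup F.subspace = F.subspace i :=
  sup_Iic_of_monotone F.monotone_subspace

theorem sup_Iio_succ_subspace (F : Flag123 n) (i : Fin 2) :
    (Iio i.succ).sup F.subspace = F.subspace i.castSucc := by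
  have hIio : Iio i.succ = Iic i.castSucc := by
    ext j
    simp [Fin.le_castSucc_iff]
  rw [hIio, sup_Iic_subspace]

theorem finrank_sup_Iio_subspace (F : Flag123 n) (i : Fin 3) :
    finrank ℝ ((Iio i).sup F.subspace : Submodule ℝ (AmbientSpace n)) = i := by
  induction i using Fin.cases with
  | zero => simp
  | succ i => rw [sup_Iio_succ_subspace, finrank_subspace, Fin.val_castSucc, Fin.val_succ]

theorem continuous_starProjection_subspace (i : Fin 3) :
    Continuous fun F : Flag123 n => (F.subspace i).starProjection :=
  continuous_iff.1 continuous_id i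

theorem continuous_starProjection_sup_Iio_subspace (i : Fin 3) :
    Continuous fun F : Flag123 n => ((Iio i).sup F.subspace).starProjection := by
  induction i using Fin.cases with
  | zero => exact continuous_of_const fun _ _ => rfl
  | succ i =>
    simp only [sup_Iio_succ_subspace]
    exact continuous_starProjection_subspace i.castSucc

/-- The triple of mutually orthogonal points spanning a flag. -/
def frame (F : Flag123 n) : IndependentPoints (Fin 3) n :=
  ⟨fun i => ⟨gramSchmidtFamily (1 : ℝ) F.subspace i, by
    have := finrank_gramSchmidtFamily_one_add_finrank F.subspace i
    rw [finrank_sup_Iio_subspace, sup_Iic_subspace, finrank_subspace] at this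
    exact Nat.add_right_cancel (this.trans (add_comm _ 1))⟩,
    iSupIndep_gramSchmidtFamily_one F.subspace⟩

theorem point_frame (F : Flag123 n) : F.frame.point = gramSchmidtFamily (1 : ℝ) F.subspace := rfl

theorem continuous_frame : Continuous (frame (n := n)) :=
  IndependentPoints.continuous_iff.2 fun i => by
    simp only [point_frame, gramSchmidtFamily_one]
    refine continuous_starProjection_inf_orthogonal (continuous_starProjection_sup_Iio_subspace i)
      ?_ fun F => sup_mono Iio_subset_Iic_self
    simpa only [sup_Iic_subspace] using continuous_starProjection_subspace i

theorem isSpannedBy_iff {F : Flag123 n} {e : Fin 3 → AmbientSpace n} :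
    F.IsSpannedBy e ↔ ∀ i, F.subspace i = (Iic i).sup fun j => ℝ ∙ e j := by
  have h₀ : Iic (0 : Fin 3) = {0} := rfl
  have h₁ : Iic (1 : Fin 3) = {0, 1} := rfl
  have h₂ : Iic (2 : Fin 3) = {0, 1, 2} := rfl
  simp [Fin.forall_fin_succ, IsSpannedBy, subspace, Submodule.span_insert, h₀, h₁, h₂]

theorem point_frame_of_isSpannedBy {F : Flag123 n} {e : Fin 3 → AmbientSpace n}
    (he : Orthonormal ℝ e) (hF : F.IsSpannedBy e) : F.frame.point = fun i => ℝ ∙ e i := by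
  rw [point_frame, funext (isSpannedBy_iff.1 hF), gramSchmidtFamily_one_sup_Iic,
    gramSchmidtFamily_of_pairwise_isOrtho]
  exact fun i j hij => Submodule.isOrtho_span.2 (by simpa using he.2 hij)

end Flag123

namespace IndependentPoints

variable {n : ℕ}

/-- The flag spanned successively by three independent points. -/
def toFlag (K : IndependentPoints (Fin 3) n) : Flag123 n :=
  ⟨(⟨(Iic 0).sup K.point, K.finrank_sup_point (Iic 0)⟩,
    ⟨(Iic 1).sup K.point, K.finrank_sup_point (Iic 1)⟩,
    ⟨(Iic 2).sup K.point, K.finrank_sup_point (Iic 2)⟩),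
    sup_mono (Iic_subset_Iic.2 (by decide : (0 : Fin 3) ≤ 1)),
    sup_mono (Iic_subset_Iic.2 (by decide : (1 : Fin 3) ≤ 2))⟩

theorem subspace_toFlag (K : IndependentPoints (Fin 3) n) :
    K.toFlag.subspace = fun i => (Iic i).sup K.point :=
  funext fun
    | 0 => rfl
    | 1 => rfl
    | 2 => rfl

theorem continuous_toFlag : Continuous (toFlag (n := n)) :=
  Flag123.continuous_iff.2 fun i => by
    simpa only [subspace_toFlag] using continuous_starProjection_sup_point (Iic i)

theorem toFlag_frame (F : Flag123 n) : F.frame.toFlag = F :=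
  Flag123.subspace_injective <| funext fun i => by
    simp only [subspace_toFlag, Flag123.point_frame]
    rw [sup_gramSchmidtFamily _ _ (coe_Iic i ▸ isLowerSet_Iic i), Flag123.sup_Iic_subspace]

theorem frame_toFlag (K : IndependentPoints (Fin 3) n) : K.toFlag.frame = K.gramSchmidt 1 :=
  point_injective <| by
    rw [Flag123.point_frame, subspace_toFlag, gramSchmidtFamily_one_sup_Iic, point_gramSchmidt]

/-- Three independent points and the flag which they span determine each other up to homotopy:
the linear Gram-Schmidt deformation moves the points to the orthogonal frame of the flag. -/
def homotopyEquivFlag123 (n : ℕ) : IndependentPoints (Fin 3) n ≃ₕ Flag123 n where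
  toFun := ⟨toFlag, continuous_toFlag⟩
  invFun := ⟨Flag123.frame, Flag123.continuous_frame⟩
  left_inv := ContinuousMap.Homotopic.symm
    ⟨{ toFun := fun x => x.2.gramSchmidt x.1
       continuous_toFun := continuous_gramSchmidt.comp
         (continuous_subtype_val.prodMap continuous_id)
       map_zero_left := gramSchmidt_zero
       map_one_left := fun K => K.frame_toFlag.symm }⟩
  right_inv := by
    have h : ContinuousMap.comp ⟨toFlag, continuous_toFlag⟩
        ⟨Flag123.frame, Flag123.continuous_frame⟩ = ContinuousMap.id (Flag123 n) :=
      ContinuousMap.ext toFlag_frame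
    exact h ▸ ContinuousMap.Homotopic.refl _

end IndependentPoints

namespace LineTriples

variable {n : ℕ}

theorem line_injective : Function.Injective (line (n := n)) := fun _ _ h =>
  Subtype.ext (funext fun i => Subtype.ext (congrFun h i))

theorem finrank_line (p : LineTriples n) (i : Fin 3) : finrank ℝ (p.line i) = 2 :=
  (p.1 i).finrank_toSubmodule

theorem pairwise_finrank_inf_line (p : LineTriples n) :
    Pairwise fun i j => finrank ℝ (p.line i ⊓ p.line j : Submodule ℝ (AmbientSpace n)) = 1 :=
  ((ProjLine.meetsAtDistinctPoints_triple_iff p.1).1 p.2).1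

theorem iInf_line (p : LineTriples n) : ⨅ i, p.line i = ⊥ :=
  ((ProjLine.meetsAtDistinctPoints_triple_iff p.1).1 p.2).2

theorem continuous_iff {X : Type*} [TopologicalSpace X] {p : X → LineTriples n} :
    Continuous p ↔ ∀ i, Continuous fun x => ((p x).line i).starProjection :=
  continuous_induced_rng.trans <|
    continuous_pi_iff.trans <| forall_congr' fun _ => RealGrassmannian.continuous_iff

theorem continuous_starProjection_line (i : Fin 3) :
    Continuous fun p : LineTriples n => (p.line i).starProjection :=
  continuous_iff.1 continuous_id i

theorem line_zero_sup_line_one (p : LineTriples n) : p.line 0 ⊔ p.line 1 = p.commonSpace := by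
  have hinf : p.line 0 ⊓ p.line 1 ⊓ p.line 2 = ⊥ := le_bot_iff.1 <| p.iInf_line ▸
    le_iInf fun
      | 0 => inf_le_left.trans inf_le_left
      | 1 => inf_le_left.trans inf_le_right
      | 2 => inf_le_right
  have hle : p.line 2 ≤ p.line 0 ⊔ p.line 1 := le_sup_of_finrank_le_add_finrank_inf hinf <| by
    rw [p.finrank_line, p.pairwise_finrank_inf_line (by decide),
      p.pairwise_finrank_inf_line (by decide)]
  rw [commonSpace, iSup_fin_three, sup_eq_left.2 hle]

theorem finrank_commonSpace (p : LineTriples n) : finrank ℝ p.commonSpace = 3 := by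
  have hdim := Submodule.finrank_sup_add_finrank_inf_eq (p.line 0) (p.line 1)
  rw [p.line_zero_sup_line_one, p.pairwise_finrank_inf_line (by decide), p.finrank_line,
    p.finrank_line] at hdim
  exact Nat.add_right_cancel hdim

theorem continuous_starProjection_commonSpace :
    Continuous fun p : LineTriples n => p.commonSpace.starProjection := by
  simp only [← line_zero_sup_line_one]
  refine continuous_starProjection_sup (continuous_starProjection_line 0)
    (continuous_starProjection_line 1) fun p => ?_
  rw [line_zero_sup_line_one, finrank_commonSpace, finrank_line]

/-- The points given by the normals to the three lines in their common `3`-space. -/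
def normals (p : LineTriples n) : IndependentPoints (Fin 3) n :=
  have hrank (i : Fin 3) : finrank ℝ (dualFamily p.line i) = 1 := by
    have := finrank_dualFamily_add_finrank p.line i
    rw [p.finrank_line] at this
    exact Nat.add_right_cancel (this.trans p.finrank_commonSpace)
  ⟨fun i => ⟨dualFamily p.line i, hrank i⟩, (iSupIndep_iff_finrank_iSup_eq_card hrank).2 <|
    (iSup_dualFamily p.iInf_line).symm ▸ p.finrank_commonSpace⟩

theorem point_normals (p : LineTriples n) : p.normals.point = dualFamily p.line := rfl

theorem continuous_normals : Continuous (normals (n := n)) :=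
  IndependentPoints.continuous_iff.2 fun i =>
    continuous_starProjection_inf_orthogonal (continuous_starProjection_line i)
      continuous_starProjection_commonSpace fun p => le_iSup p.line i

end LineTriples

namespace IndependentPoints

variable {n : ℕ}

theorem iInf_point {ι : Type*} [Nontrivial ι] (K : IndependentPoints ι n) :
    ⨅ i, K.point i = ⊥ := by
  obtain ⟨i, j, hij⟩ := exists_pair_ne ι
  exact le_bot_iff.1 <| (K.iSupIndep_point.pairwiseDisjoint hij).le_bot.trans' <|
    le_inf (iInf_le _ i) (iInf_le _ j)

theorem finrank_iSup_point {ι : Type*} [Fintype ι] (K : IndependentPoints ι n) :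
    finrank ℝ (⨆ i, K.point i : Submodule ℝ (AmbientSpace n)) = Fintype.card ι :=
  (iSupIndep_iff_finrank_iSup_eq_card K.finrank_point).1 K.iSupIndep_point

/-- The triple of lines polar to three independent points in the `3`-space which they span. -/
def polarLines (K : IndependentPoints (Fin 3) n) : LineTriples n :=
  have hrank (i : Fin 3) : finrank ℝ (dualFamily K.point i) = 2 := by
    have := finrank_dualFamily_add_finrank K.point i
    rw [K.finrank_point, K.finrank_iSup_point] at this
    exact Nat.add_right_cancel this
  have hinf : Pairwise fun i j => finrank ℝ
      (dualFamily K.point i ⊓ dualFamily K.point j : Submodule ℝ (AmbientSpace n)) = 1 := by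
    intro i j hij
    have hsup := K.finrank_sup_point {i, j}
    rw [sup_insert, sup_singleton, card_pair hij] at hsup
    have := finrank_dualFamily_inf_add_finrank_sup K.point i j
    rw [hsup, K.finrank_iSup_point] at this
    exact Nat.add_right_cancel this
  let ℓ (i : Fin 3) : ProjLine n := ⟨dualFamily K.point i, hrank i⟩
  ⟨ℓ, (ProjLine.meetsAtDistinctPoints_triple_iff ℓ).2 ⟨hinf, iInf_dualFamily K.point⟩⟩

theorem line_polarLines (K : IndependentPoints (Fin 3) n) :
    K.polarLines.line = dualFamily K.point := rfl

theorem continuous_polarLines : Continuous (polarLines (n := n)) :=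
  LineTriples.continuous_iff.2 fun i => by
    refine continuous_starProjection_inf_orthogonal (continuous_starProjection_point i) ?_
      fun K => le_iSup K.point i
    simpa only [sup_univ_eq_iSup] using continuous_starProjection_sup_point univ

end IndependentPoints

/-- Polar duality between triangles of lines and triples of independent points. -/
def LineTriples.normalsHomeomorph (n : ℕ) : LineTriples n ≃ₜ IndependentPoints (Fin 3) n where
  toFun := normals
  invFun := IndependentPoints.polarLines
  left_inv p := line_injective <| by
    rw [IndependentPoints.line_polarLines, point_normals, dualFamily_dualFamily p.iInf_line]
  right_inv K := IndependentPoints.point_injective <| by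
    rw [point_normals, IndependentPoints.line_polarLines, dualFamily_dualFamily K.iInf_point]
  continuous_toFun := continuous_normals
  continuous_invFun := IndependentPoints.continuous_polarLines

theorem LineTriples.IsNormalFrame.point_normals_eq_span {n : ℕ} {p : LineTriples n}
    {e : Fin 3 → AmbientSpace n} (he : p.IsNormalFrame e) :
    p.normals.point = fun i => ℝ ∙ e i :=
  funext fun i => eq_span_singleton_of_finrank_eq_one (p.normals.finrank_point i)
    ⟨(he i).2.1, (he i).2.2⟩ (he i).1

theorem Flag123.iSup_point_frame {n : ℕ} (F : Flag123 n) : ⨆ i, F.frame.point i = F.V₃ := by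
  have h := congrFun (congrArg Flag123.subspace (IndependentPoints.toFlag_frame F)) 2
  rw [IndependentPoints.subspace_toFlag] at h
  rw [← sup_univ_eq_iSup]
  exact h

end

theorem theorem5 (n : ℕ) :
    ∃ h : LineTriples n ≃ₕ Flag123 n,
      (∀ (p : LineTriples n) (e : Fin 3 → AmbientSpace n),
        p.IsNormalFrame e → Flag123.IsSpannedBy (h.toFun p) e) ∧
      (∀ (F : Flag123 n) (e : Fin 3 → AmbientSpace n),
        Orthonormal ℝ e → F.IsSpannedBy e →
          ∀ i, LineTriples.line (h.invFun F) i = F.V₃ ⊓ (Submodule.span ℝ {e i})ᗮ) := by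
  refine ⟨(LineTriples.normalsHomeomorph n).toHomotopyEquiv.trans
    (IndependentPoints.homotopyEquivFlag123 n), fun p e he => ?_, fun F e he hF i => ?_⟩
  · have hflag : p.normals.toFlag.subspace = fun i => (Iic i).sup fun j => ℝ ∙ e j := by
      rw [IndependentPoints.subspace_toFlag, he.point_normals_eq_span]
    exact Flag123.isSpannedBy_iff.2 (congrFun hflag)
  · calc F.frame.polarLines.line i
        = (⨆ j, F.frame.point j) ⊓ (F.frame.point i)ᗮ :=
          congrFun F.frame.line_polarLines i
      _ = F.V₃ ⊓ (ℝ ∙ e i)ᗮ := by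
        rw [F.iSup_point_frame, Flag123.point_frame_of_isSpannedBy he hF]
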